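/- Let $d\ge 1$. For probability measures $\mu,\nu$ on $\mathbb R^d$ with finite second moments let $\Pi(\mu,\nu)$ be the set of probability measures on $\mathbb R^d\times\mathbb R^d$ with first marginal $\mu$ and second marginal $\nu$, and let $$W_2^2(\mu,\nu)=\inf_{\gamma\in\Pi(\mu,\nu)}\int\|y_0-y_1\|^2\,d\gamma(y_0,y_1).$$ A finite Gaussian mixture on $\mathbb R^n$ is a probability measure $\sum_{k=1}^K\pi^k\,\mathcal N(m^k,\Sigma^k)$ with $K\ge 1$, $\pi^k\ge 0$, $\sum_k\pi^k=1$, $m^k\in\mathbb R^n$ and $\Sigma^k$ symmetric positive semidefinite (possibly singular, so that Dirac masses are allowed as components). For finite Gaussian mixtures $\mu,\nu$ on $\mathbb R^d$ let $MW_2^2(\mu,\nu)$ be the infimum of the same integral over those $\gamma\in\Pi(\mu,\nu)$ that are finite Gaussian mixtures on $\mathbb R^d\times\mathbb R^d=\mathbb R^{2d}$. Let $\mu_i=\sum_{k=1}^{K_i}\pi_i^k\,\mathcal N(m_i^k,\Sigma_i^k)$, $i=0,1$, be two finite Gaussian mixtures on $\mathbb R^d$. Then $W_2(\mu_0,\mu_1)$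 and $MW_2(\mu_0,\mu_1)$ are finite and $$W_2(\mu_0,\mu_1)\le MW_2(\mu_0,\mu_1)\le W_2(\mu_0,\mu_1)+\sum_{i=0,1}\Bigl(2\sum_{k=1}^{K_i}\pi_i^k\,\mathrm{tr}(\Sigma_i^k)\Bigr)^{1/2}.$$ Moreover $W_2(\mu_0,\mu_1)=MW_2(\mu_0,\mu_1)$ in each of the following cases: 1. $\mu_0$ and $\mu_1$ are both Gaussian measures; 2. $\mu_0$ and $\mu_1$ are both finite convex combinations of Dirac masses; 3. $\mu_1=T_\#\mu_0$ is the image of $\mu_0$ under an affine map $T(x)=Ax+b$ whose linear part $A$ is symmetric positive semidefinite. -/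

import Mathlib

open MeasureTheory ProbabilityTheory
open scoped ENNReal

/-- `γ` is a coupling (transport plan) of `μ` and `ν`: its two marginals are `μ` and `ν`. When `μ` is
a probability measure, so is `γ`. -/
def IsCoupling {E : Type*} [MeasurableSpace E] (γ : Measure (E × E)) (μ ν : Measure E) : Prop :=
  γ.map Prod.fst = μ ∧ γ.map Prod.snd = ν

/-- `μ` is a finite Gaussian mixture: a convex combination of finitely many, possibly degenerate,
Gaussian measures. The definition makes sense on `ℝ^d` and on `ℝ^d × ℝ^d = ℝ^{2d}` alike. -/
def IsGaussianMixture {F : Type*} [TopologicalSpace F] [AddCommMonoid F] [Module ℝ F]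
    [MeasurableSpace F] (μ : Measure F) : Prop :=
  ∃ (K : ℕ) (p : Fin K → ℝ) (c : Fin K → Measure F),
    p ∈ stdSimplex ℝ (Fin K) ∧ (∀ k, IsGaussian (c k)) ∧ μ = ∑ k, ENNReal.ofReal (p k) • c k

/-- `μ` is a finite combination of Dirac masses. -/
def IsDiracMixture {E : Type*} [MeasurableSpace E] (μ : Measure E) : Prop :=
  ∃ (K : ℕ) (p : Fin K → ℝ) (y : Fin K → E),
    p ∈ stdSimplex ℝ (Fin K) ∧ μ = ∑ k, ENNReal.ofReal (p k) • Measure.dirac (y k)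

noncomputable section

/-- The quadratic transport cost of a plan, `∫ ‖y₀ - y₁‖² dγ(y₀, y₁)`, with values in `[0, ∞]`. -/
def quadCost {d : ℕ} (γ : Measure (EuclideanSpace ℝ (Fin d) × EuclideanSpace ℝ (Fin d))) : ℝ≥0∞ :=
  ∫⁻ y, ‖y.1 - y.2‖ₑ ^ 2 ∂γ

/-- The 2-Wasserstein distance on `ℝ^d`. -/
def W2 {d : ℕ} (μ ν : Measure (EuclideanSpace ℝ (Fin d))) : ℝ≥0∞ :=
  (⨅ γ ∈ {γ | IsCoupling γ μ ν}, quadCost γ) ^ (1 / 2 : ℝ)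

/-- The mixture Wasserstein distance on `ℝ^d`: as `W2`, but only over the couplings that are
finite Gaussian mixtures on `ℝ^d × ℝ^d`. -/
def MW2 {d : ℕ} (μ ν : Measure (EuclideanSpace ℝ (Fin d))) : ℝ≥0∞ :=
  (⨅ γ ∈ {γ | IsCoupling γ μ ν ∧ IsGaussianMixture γ}, quadCost γ) ^ (1 / 2 : ℝ)

/-- The Gaussian mixture `∑ k, p k • 𝒩(m k, S k)` on `ℝ^d`. -/
def gaussianMixture {d K : ℕ} (p : Fin K → ℝ) (m : Fin K → EuclideanSpace ℝ (Fin d))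
    (S : Fin K → Matrix (Fin d) (Fin d) ℝ) : Measure (EuclideanSpace ℝ (Fin d)) :=
  ∑ k, ENNReal.ofReal (p k) • multivariateGaussian (m k) (S k)

end

/-! Upper bound: let `γ` be any plan and `(x, x')` a pair with law `γ`. Draw labels `i`, `j` from
the posterior probabilities of the components given `x` and `x'`, then fresh independent points `y`
from `c i` and `y'` from `c' j`. The law of `(y, y')` is a mixture of the products `c i ⊗ c' j`,
hence an admissible plan. Given `i`, the points `x` and `y` are independent copies of `c i`, so the
mean of `‖x - y‖²` is the weighted sum of `2 tr Σ`. Minkowski's inequality in L² finishes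
(`exists_isGaussianMixture_coupling_quadCost_le`).

Equality cases: every plan can be replaced by a Gaussian mixture plan that costs no more. Between
Gaussians, take the Gaussian with the same mean and covariance
(`exists_isGaussian_coupling_quadCost_eq`). Between Dirac mixtures, every plan is finitely supported
and already a mixture. For an affine map with positive linear part, the graph plan is a mixture, as
an affine image of one, and is optimal by quadratic Kantorovich potentials (`quadCost_graph_le`). -/

/-! ### Marginals and moments of couplings. -/

section Couplings

variable {E : Type*} [MeasurableSpace E] {μ ν : Measure E} {γ : Measure (E × E)}

lemma IsCoupling.lintegral_fst (h : IsCoupling γ μ ν) {f : E → ℝ≥0∞} (hf : Measurable f) :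
    ∫⁻ z, f z.1 ∂γ = ∫⁻ x, f x ∂μ := by
  rw [← h.1, lintegral_map hf measurable_fst]

lemma IsCoupling.lintegral_snd (h : IsCoupling γ μ ν) {f : E → ℝ≥0∞} (hf : Measurable f) :
    ∫⁻ z, f z.2 ∂γ = ∫⁻ x, f x ∂ν := by
  rw [← h.2, lintegral_map hf measurable_snd]

lemma IsCoupling.isProbabilityMeasure (h : IsCoupling γ μ ν) [IsProbabilityMeasure μ] :
    IsProbabilityMeasure γ := by
  have : IsProbabilityMeasure (γ.map Prod.fst) := by rwa [h.1]
  exact Measure.isProbabilityMeasure_of_map Prod.fst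

lemma isCoupling_prod [IsProbabilityMeasure μ] [IsProbabilityMeasure ν] :
    IsCoupling (μ.prod ν) μ ν := by
  constructor
  · simp [Measure.map_fst_prod]
  · simp [Measure.map_snd_prod]

lemma IsCoupling.memLp_id {E : Type*} [NormedAddCommGroup E] [MeasurableSpace E] [BorelSpace E]
    [SecondCountableTopology E] {μ ν : Measure E} {γ : Measure (E × E)}
    (h : IsCoupling γ μ ν) {p : ℝ≥0∞} (hμ : MemLp id p μ) (hν : MemLp id p ν) : MemLp id p γ := by
  refine memLp_prod_iff.2 ⟨?_, ?_⟩
  · exact (memLp_map_measure_iff (f := Prod.fst) (by fun_prop) (by fun_prop)).1 (h.1.symm ▸ hμ)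
  · exact (memLp_map_measure_iff (f := Prod.snd) (by fun_prop) (by fun_prop)).1 (h.2.symm ▸ hν)

end Couplings

/-! ### Stability properties of finite Gaussian mixtures. -/

section Mixtures

lemma isGaussianMixture_sum {ι F : Type*} [Fintype ι] [TopologicalSpace F] [AddCommMonoid F]
    [Module ℝ F] [MeasurableSpace F] (w : ι → ℝ≥0∞) (c : ι → Measure F) (hw : ∑ i, w i = 1)
    (hc : ∀ i, IsGaussian (c i)) : IsGaussianMixture (∑ i, w i • c i) := by
  have hfin : ∀ i, w i ≠ ∞ := fun i => by
    have : w i ≤ 1 := hw ▸ Finset.single_le_sum (fun _ _ => zero_le) (Finset.mem_univ i)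
    exact (this.trans_lt ENNReal.one_lt_top).ne
  let e := Fintype.equivFin ι
  refine ⟨Fintype.card ι, fun k => (w (e.symm k)).toReal, fun k => c (e.symm k),
    ⟨fun _ => ENNReal.toReal_nonneg, ?_⟩, fun k => hc _, ?_⟩
  · rw [e.symm.sum_comp (fun i => (w i).toReal), ← ENNReal.toReal_sum (fun i _ => hfin i), hw,
      ENNReal.toReal_one]
  · simp_rw [ENNReal.ofReal_toReal (hfin _)]
    exact (e.symm.sum_comp (fun i => w i • c i)).symm

lemma IsGaussian.isGaussianMixture {F : Type*} [TopologicalSpace F] [AddCommMonoid F]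
    [Module ℝ F] [MeasurableSpace F] {μ : Measure F} (h : IsGaussian μ) : IsGaussianMixture μ := by
  simpa using isGaussianMixture_sum (fun _ : Unit => 1) (fun _ => μ) (by simp) (fun _ => h)

lemma sum_ofReal_of_mem_stdSimplex {ι : Type*} [Fintype ι] {p : ι → ℝ}
    (hp : p ∈ stdSimplex ℝ ι) : ∑ i, ENNReal.ofReal (p i) = 1 := by
  rw [← ENNReal.ofReal_sum_of_nonneg (fun i _ => hp.1 i), hp.2, ENNReal.ofReal_one]

lemma isProbabilityMeasure_sum_smul {ι F : Type*} [Fintype ι] [MeasurableSpace F]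
    {w : ι → ℝ≥0∞} {c : ι → Measure F} (hw : ∑ i, w i = 1) [∀ i, IsProbabilityMeasure (c i)] :
    IsProbabilityMeasure (∑ i, w i • c i) :=
  ⟨by simp [Measure.finsetSum_apply, hw]⟩

lemma memLp_sum_smul_measure {ι F G : Type*} [Fintype ι] [MeasurableSpace F]
    [NormedAddCommGroup G] {w : ι → ℝ≥0∞} {c : ι → Measure F} (hw : ∀ i, w i ≠ ∞) {f : F → G}
    {p : ℝ≥0∞} (hp₀ : p ≠ 0) (hp : p ≠ ∞) (hf : StronglyMeasurable f) (h : ∀ i, MemLp f p (c i)) :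
    MemLp f p (∑ i, w i • c i) := by
  refine ⟨hf.aestronglyMeasurable, ?_⟩
  rw [eLpNorm_lt_top_iff_lintegral_rpow_enorm_lt_top hp₀ hp, lintegral_finsetSum_measure]
  refine ENNReal.sum_lt_top.2 fun i _ => ?_
  rw [lintegral_smul_measure]
  exact ENNReal.mul_lt_top (hw i).lt_top
    ((eLpNorm_lt_top_iff_lintegral_rpow_enorm_lt_top hp₀ hp).1 (h i).2)

lemma IsGaussianMixture.isProbabilityMeasure {F : Type*} [TopologicalSpace F] [AddCommMonoid F]
    [Module ℝ F] [MeasurableSpace F] {μ : Measure F} (h : IsGaussianMixture μ) :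
    IsProbabilityMeasure μ := by
  obtain ⟨K, p, c, hp, hc, rfl⟩ := h
  exact isProbabilityMeasure_sum_smul (sum_ofReal_of_mem_stdSimplex hp)

lemma IsGaussianMixture.memLp_two_id {F : Type*} [NormedAddCommGroup F] [NormedSpace ℝ F]
    [CompleteSpace F] [SecondCountableTopology F] [MeasurableSpace F] [BorelSpace F] {μ : Measure F}
    (h : IsGaussianMixture μ) : MemLp id 2 μ := by
  obtain ⟨K, p, c, hp, hc, rfl⟩ := h
  exact memLp_sum_smul_measure (fun _ => ENNReal.ofReal_ne_top) (by norm_num) (by norm_num)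
    stronglyMeasurable_id fun i => IsGaussian.memLp_two_id

lemma IsGaussianMixture.prod {F G : Type*} [NormedAddCommGroup F] [NormedSpace ℝ F]
    [SecondCountableTopology F] [MeasurableSpace F] [BorelSpace F]
    [NormedAddCommGroup G] [NormedSpace ℝ G] [SecondCountableTopology G] [MeasurableSpace G]
    [BorelSpace G] [CompleteSpace F] [CompleteSpace G] {μ : Measure F} {ν : Measure G}
    (hμ : IsGaussianMixture μ) (hν : IsGaussianMixture ν) : IsGaussianMixture (μ.prod ν) := by
  have := hν.isProbabilityMeasure
  obtain ⟨K, p, c, hp, hc, rfl⟩ := hμ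
  obtain ⟨K', p', c', hp', hc', rfl⟩ := hν
  have key := isGaussianMixture_sum
    (fun i : Fin K × Fin K' => ENNReal.ofReal (p i.1) * ENNReal.ofReal (p' i.2))
    (fun i => (c i.1).prod (c' i.2)) ?_ (fun i => inferInstance)
  · convert key
    rw [← Measure.sum_fintype, Measure.prod_sum_left, Measure.sum_fintype, Fintype.sum_prod_type]
    refine Finset.sum_congr rfl fun k _ => ?_
    rw [← Measure.sum_fintype, Measure.prod_sum_right, Measure.sum_fintype]
    refine Finset.sum_congr rfl fun l _ => ?_
    rw [Measure.prod_smul_left, Measure.prod_smul_right, smul_smul]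
  · rw [Fintype.sum_prod_type]
    dsimp only
    rw [← Finset.sum_mul_sum, sum_ofReal_of_mem_stdSimplex hp,
      sum_ofReal_of_mem_stdSimplex hp', one_mul]

lemma IsGaussianMixture.map_clm_add_const {F G : Type*} [NormedAddCommGroup F] [NormedSpace ℝ F]
    [MeasurableSpace F] [BorelSpace F] [NormedAddCommGroup G] [NormedSpace ℝ G]
    [SecondCountableTopology G] [MeasurableSpace G] [BorelSpace G] {μ : Measure F}
    (hμ : IsGaussianMixture μ) (A : F →L[ℝ] G) (b : G) :
    IsGaussianMixture (μ.map fun x => A x + b) := by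
  obtain ⟨K, p, c, hp, hc, rfl⟩ := hμ
  refine ⟨K, p, fun k => (c k).map fun x => A x + b, hp, fun k => ?_, ?_⟩
  · have : (fun x => A x + b) = (fun y => y + b) ∘ A := rfl
    dsimp only
    rw [this, ← Measure.map_map (by fun_prop) (by fun_prop)]
    infer_instance
  · rw [Measure.map_finset_sum' (by fun_prop)]
    simp_rw [Measure.map_smul]

end Mixtures

/-! ### Comparing `W2` and `MW2` plan by plan. -/

section Wasserstein

variable {d : ℕ} {μ ν : Measure (EuclideanSpace ℝ (Fin d))}

lemma measurable_enorm_sub_sq {E : Type*} [NormedAddCommGroup E] [MeasurableSpace E] [BorelSpace E]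
    [SecondCountableTopology E] : Measurable fun z : E × E => ‖z.1 - z.2‖ₑ ^ 2 := by
  fun_prop

/-- The square root moves across the infimum, so bounds can be tested on each plan and no optimal
plan has to exist. -/
lemma le_W2 {a : ℝ≥0∞} (h : ∀ γ, IsCoupling γ μ ν → a ≤ quadCost γ ^ (1 / 2 : ℝ)) :
    a ≤ W2 μ ν := by
  simp only [one_div] at h
  rw [W2, one_div, ENNReal.le_rpow_inv_iff (by norm_num)]
  refine le_iInf₂ fun γ hγ => ?_
  rw [← ENNReal.le_rpow_inv_iff (by norm_num)]
  exact h γ hγ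

lemma MW2_le {γ : Measure (EuclideanSpace ℝ (Fin d) × EuclideanSpace ℝ (Fin d))}
    (h : IsCoupling γ μ ν) (hγ : IsGaussianMixture γ) : MW2 μ ν ≤ quadCost γ ^ (1 / 2 : ℝ) :=
  ENNReal.rpow_le_rpow (iInf₂_le γ ⟨h, hγ⟩) (by norm_num)

lemma W2_le_MW2 : W2 μ ν ≤ MW2 μ ν :=
  ENNReal.rpow_le_rpow (le_iInf₂ fun γ hγ => iInf₂_le γ hγ.1) (by norm_num)

/-- Common form of the three equality cases. -/
lemma W2_eq_MW2_of_forall_exists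
    (h : ∀ γ, IsCoupling γ μ ν →
      ∃ γ', IsCoupling γ' μ ν ∧ IsGaussianMixture γ' ∧ quadCost γ' ≤ quadCost γ) :
    W2 μ ν = MW2 μ ν := by
  refine le_antisymm W2_le_MW2 (le_W2 fun γ hγ => ?_)
  obtain ⟨γ', h₁, h₂, h₃⟩ := h γ hγ
  exact (MW2_le h₁ h₂).trans (ENNReal.rpow_le_rpow h₃ (by norm_num))

lemma quadCost_eq_ofReal_integral
    {γ : Measure (EuclideanSpace ℝ (Fin d) × EuclideanSpace ℝ (Fin d))} (hγ : MemLp id 2 γ) :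
    Integrable (fun z => ‖z.1 - z.2‖ ^ 2) γ ∧
      quadCost γ = ENNReal.ofReal (∫ z, ‖z.1 - z.2‖ ^ 2 ∂γ) := by
  have h : MemLp (fun z : EuclideanSpace ℝ (Fin d) × EuclideanSpace ℝ (Fin d) => z.1 - z.2) 2 γ :=
    (memLp_prod_iff.1 hγ).1.sub (memLp_prod_iff.1 hγ).2
  have hi := h.integrable_norm_pow (by norm_num)
  refine ⟨hi, ?_⟩
  rw [ofReal_integral_eq_lintegral_ofReal hi (ae_of_all _ fun z => by positivity), quadCost]
  simp_rw [ENNReal.ofReal_pow (norm_nonneg _), ofReal_norm]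

lemma MW2_ne_top (hμ : IsGaussianMixture μ) (hν : IsGaussianMixture ν) : MW2 μ ν ≠ ∞ := by
  have := hμ.isProbabilityMeasure
  have := hν.isProbabilityMeasure
  refine ne_top_of_le_ne_top ?_ (MW2_le isCoupling_prod (hμ.prod hν))
  rw [(quadCost_eq_ofReal_integral (hμ.prod hν).memLp_two_id).2]
  exact ENNReal.rpow_ne_top_of_nonneg (by norm_num) ENNReal.ofReal_ne_top

end Wasserstein

/-! ### Posterior label probabilities and resampling. -/

section Posterior

/-- The posteriors are Radon–Nikodym derivatives against the sum itself, so degenerate components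
need no separate treatment. -/
lemma exists_posterior {ι F : Type*} [Fintype ι] [MeasurableSpace F] (ν : ι → Measure F)
    [∀ i, IsFiniteMeasure (ν i)] :
    ∃ ρ : ι → F → ℝ≥0∞, (∀ i, Measurable (ρ i)) ∧ (∀ i, (∑ j, ν j).withDensity (ρ i) = ν i) ∧
      ∀ᵐ x ∂(∑ j, ν j), ∑ i, ρ i x = 1 := by
  set μ := ∑ j, ν j with hμ
  have hle : ∀ i, ν i ≤ μ := fun i =>
    Finset.single_le_sum (fun _ _ => Measure.zero_le _) (Finset.mem_univ i)
  have hdens : ∀ i, μ.withDensity ((ν i).rnDeriv μ) = ν i := fun i =>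
    Measure.withDensity_rnDeriv_eq _ _ (hle i).absolutelyContinuous
  refine ⟨fun i => (ν i).rnDeriv μ, fun i => Measure.measurable_rnDeriv _ _, hdens, ?_⟩
  have hm : Measurable fun x => ∑ i, (ν i).rnDeriv μ x :=
    Finset.measurable_fun_sum _ fun i _ => Measure.measurable_rnDeriv _ _
  -- Both sides are densities of `μ` with respect to itself, and densities are unique a.e.
  refine (withDensity_eq_iff_of_sigmaFinite hm.aemeasurable aemeasurable_const).1 ?_
  ext s hs
  rw [withDensity_apply _ hs, lintegral_finsetSum _ fun i _ => Measure.measurable_rnDeriv _ _,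
    withDensity_const, one_smul]
  conv_rhs => rw [hμ, Measure.finsetSum_apply]
  refine Finset.sum_congr rfl fun i _ => ?_
  rw [← withDensity_apply _ hs, hdens]

lemma sum_lintegral_mul_eq_lintegral {κ Ω : Type*} [Fintype κ] [MeasurableSpace Ω] {γ : Measure Ω}
    {τ : κ → Ω → ℝ≥0∞} (hτ : ∀ j, Measurable (τ j)) (h1 : ∀ᵐ z ∂γ, ∑ j, τ j z = 1)
    {g : Ω → ℝ≥0∞} (hg : Measurable g) : ∑ j, ∫⁻ z, τ j z * g z ∂γ = ∫⁻ z, g z ∂γ := by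
  have hm : ∀ j, Measurable fun z => τ j z * g z := fun j => (hτ j).mul hg
  rw [← lintegral_finsetSum _ fun j _ => hm j]
  refine lintegral_congr_ae ?_
  filter_upwards [h1] with z hz
  rw [← Finset.sum_mul, hz, one_mul]

variable {E : Type*} [MeasurableSpace E] {ι κ : Type*} [Fintype ι] [Fintype κ]

/-- The law of a pair `((x, x'), (y, y'))`, where `(x, x')` has law `γ`, a pair of labels `(i, j)`
is drawn with conditional probability `ρ i x * σ j x'`, and `(y, y')` is drawn from `c i ⊗ c' j`. -/
noncomputable def resample (γ : Measure (E × E)) (ρ : ι → E → ℝ≥0∞) (σ : κ → E → ℝ≥0∞)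
    (c : ι → Measure E) (c' : κ → Measure E) : Measure ((E × E) × E × E) :=
  ∑ i, ∑ j, (γ.withDensity fun z => ρ i z.1 * σ j z.2).prod ((c i).prod (c' j))

variable {γ : Measure (E × E)} {ρ : ι → E → ℝ≥0∞} {σ : κ → E → ℝ≥0∞}
  {c : ι → Measure E} {c' : κ → Measure E}

lemma lintegral_resample [∀ i, IsProbabilityMeasure (c i)] [∀ j, IsProbabilityMeasure (c' j)]
    (hρ : ∀ i, Measurable (ρ i)) (hσ : ∀ j, Measurable (σ j)) [SFinite γ]
    {f : (E × E) × E × E → ℝ≥0∞} (hf : Measurable f) :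
    ∫⁻ t, f t ∂(resample γ ρ σ c c') = ∑ i, ∑ j, ∫⁻ z, ρ i z.1 * σ j z.2 *
      ∫⁻ w, f (z, w) ∂((c i).prod (c' j)) ∂γ := by
  rw [resample, lintegral_finsetSum_measure]
  refine Finset.sum_congr rfl fun i _ => ?_
  rw [lintegral_finsetSum_measure]
  refine Finset.sum_congr rfl fun j _ => ?_
  have hm : Measurable fun z : E × E => ρ i z.1 * σ j z.2 := by
    have := hρ i
    have := hσ j
    fun_prop
  rw [lintegral_prod _ hf.aemeasurable,
    lintegral_withDensity_eq_lintegral_mul _ hm hf.lintegral_prod_right']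
  rfl

/-- Summing out `j` and then projecting `γ` to `μ` leaves `(x, y)` with law `∑ i, (ρ i μ) ⊗ c i`.
When `ρ i μ = a i • c i`, the `i`-th term is `a i` times the law of two independent copies of `c i`.
-/
lemma lintegral_resample_fst_fst [∀ i, IsProbabilityMeasure (c i)]
    [∀ j, IsProbabilityMeasure (c' j)] (hρ : ∀ i, Measurable (ρ i)) (hσ : ∀ j, Measurable (σ j))
    [SFinite γ] {μ ν : Measure E} (hγ : IsCoupling γ μ ν) (hσ1 : ∀ᵐ x ∂ν, ∑ j, σ j x = 1)
    {f : E × E → ℝ≥0∞} (hf : Measurable f) :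
    ∫⁻ t, f (t.1.1, t.2.1) ∂(resample γ ρ σ c c') =
      ∑ i, ∫⁻ p, f p ∂((μ.withDensity (ρ i)).prod (c i)) := by
  rw [lintegral_resample hρ hσ (f := fun t => f (t.1.1, t.2.1)) (by fun_prop)]
  refine Finset.sum_congr rfl fun i _ => ?_
  have hσ1' : ∀ᵐ z ∂γ, ∑ j, σ j z.2 = 1 :=
    ae_of_ae_map (p := fun x => ∑ j, σ j x = 1) measurable_snd.aemeasurable (by rwa [hγ.2])
  have hg : Measurable fun x => ∫⁻ y, f (x, y) ∂(c i) := hf.lintegral_prod_right'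
  have hm : Measurable fun x => ρ i x * ∫⁻ y, f (x, y) ∂(c i) := (hρ i).mul hg
  have hfst : ∀ (j : κ) (z : E × E), ∫⁻ w, f (z.1, w.1) ∂((c i).prod (c' j)) =
      ∫⁻ y, f (z.1, y) ∂(c i) := fun j z => by
    rw [lintegral_prod _ (by fun_prop)]
    simp
  simp_rw [hfst, mul_comm (ρ i _), mul_assoc]
  rw [sum_lintegral_mul_eq_lintegral (τ := fun j (z : E × E) => σ j z.2)
    (fun j => (hσ j).comp measurable_snd) hσ1'
    (g := fun z => ρ i z.1 * ∫⁻ y, f (z.1, y) ∂(c i)) (hm.comp measurable_fst),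
    hγ.lintegral_fst (f := fun x => ρ i x * ∫⁻ y, f (x, y) ∂(c i)) hm,
    lintegral_prod _ hf.aemeasurable,
    lintegral_withDensity_eq_lintegral_mul _ (hρ i) hg]
  rfl

lemma lintegral_resample_snd_snd [∀ i, IsProbabilityMeasure (c i)]
    [∀ j, IsProbabilityMeasure (c' j)] (hρ : ∀ i, Measurable (ρ i)) (hσ : ∀ j, Measurable (σ j))
    [SFinite γ] {μ ν : Measure E} (hγ : IsCoupling γ μ ν) (hρ1 : ∀ᵐ x ∂μ, ∑ i, ρ i x = 1)
    {f : E × E → ℝ≥0∞} (hf : Measurable f) :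
    ∫⁻ t, f (t.1.2, t.2.2) ∂(resample γ ρ σ c c') =
      ∑ j, ∫⁻ p, f p ∂((ν.withDensity (σ j)).prod (c' j)) := by
  rw [lintegral_resample hρ hσ (f := fun t => f (t.1.2, t.2.2)) (by fun_prop), Finset.sum_comm]
  refine Finset.sum_congr rfl fun j _ => ?_
  have hρ1' : ∀ᵐ z ∂γ, ∑ i, ρ i z.1 = 1 :=
    ae_of_ae_map (p := fun x => ∑ i, ρ i x = 1) measurable_fst.aemeasurable (by rwa [hγ.1])
  have hg : Measurable fun x => ∫⁻ y, f (x, y) ∂(c' j) := hf.lintegral_prod_right'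
  have hm : Measurable fun x => σ j x * ∫⁻ y, f (x, y) ∂(c' j) := (hσ j).mul hg
  have hsnd : ∀ (i : ι) (z : E × E), ∫⁻ w, f (z.2, w.2) ∂((c i).prod (c' j)) =
      ∫⁻ y, f (z.2, y) ∂(c' j) := fun i z => by
    rw [lintegral_prod _ (by fun_prop)]
    simp
  simp_rw [hsnd, mul_assoc]
  rw [sum_lintegral_mul_eq_lintegral (τ := fun i (z : E × E) => ρ i z.1)
    (fun i => (hρ i).comp measurable_fst) hρ1'
    (g := fun z => σ j z.2 * ∫⁻ y, f (z.2, y) ∂(c' j)) (hm.comp measurable_snd),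
    hγ.lintegral_snd (f := fun x => σ j x * ∫⁻ y, f (x, y) ∂(c' j)) hm,
    lintegral_prod _ hf.aemeasurable,
    lintegral_withDensity_eq_lintegral_mul _ (hσ j) hg]
  rfl

lemma lintegral_resample_fst [∀ i, IsProbabilityMeasure (c i)]
    [∀ j, IsProbabilityMeasure (c' j)] (hρ : ∀ i, Measurable (ρ i)) (hσ : ∀ j, Measurable (σ j))
    [SFinite γ] {μ ν : Measure E} (hγ : IsCoupling γ μ ν) (hρ1 : ∀ᵐ x ∂μ, ∑ i, ρ i x = 1)
    (hσ1 : ∀ᵐ x ∂ν, ∑ j, σ j x = 1) {f : E × E → ℝ≥0∞} (hf : Measurable f) :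
    ∫⁻ t, f t.1 ∂(resample γ ρ σ c c') = ∫⁻ z, f z ∂γ := by
  rw [lintegral_resample hρ hσ (f := fun t => f t.1) (by fun_prop)]
  have hρ1' : ∀ᵐ z ∂γ, ∑ i, ρ i z.1 = 1 :=
    ae_of_ae_map (p := fun x => ∑ i, ρ i x = 1) measurable_fst.aemeasurable (by rwa [hγ.1])
  have hσ1' : ∀ᵐ z ∂γ, ∑ j, σ j z.2 = 1 :=
    ae_of_ae_map (p := fun x => ∑ j, σ j x = 1) measurable_snd.aemeasurable (by rwa [hγ.2])
  have hρm : ∀ i, Measurable fun z : E × E => ρ i z.1 := fun i => (hρ i).comp measurable_fst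
  have hσm : ∀ j, Measurable fun z : E × E => σ j z.2 := fun j => (hσ j).comp measurable_snd
  simp only [lintegral_const, measure_univ, mul_one, mul_assoc]
  rw [Finset.sum_comm]
  have hm : ∀ j, Measurable fun z : E × E => σ j z.2 * f z := fun j => (hσm j).mul hf
  simp_rw [fun j => sum_lintegral_mul_eq_lintegral hρm hρ1' (hm j)]
  exact sum_lintegral_mul_eq_lintegral hσm hσ1' hf

/-- The law of the resampled pair `(y, y')` under `resample γ ρ σ c c'`. -/
noncomputable def resampledPair (γ : Measure (E × E)) (ρ : ι → E → ℝ≥0∞) (σ : κ → E → ℝ≥0∞)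
    (c : ι → Measure E) (c' : κ → Measure E) : Measure (E × E) :=
  ∑ p : ι × κ, (∫⁻ z, ρ p.1 z.1 * σ p.2 z.2 ∂γ) • (c p.1).prod (c' p.2)

lemma lintegral_resample_snd [∀ i, IsProbabilityMeasure (c i)]
    [∀ j, IsProbabilityMeasure (c' j)] (hρ : ∀ i, Measurable (ρ i)) (hσ : ∀ j, Measurable (σ j))
    [SFinite γ] {f : E × E → ℝ≥0∞} (hf : Measurable f) :
    ∫⁻ t, f t.2 ∂(resample γ ρ σ c c') = ∫⁻ w, f w ∂(resampledPair γ ρ σ c c') := by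
  rw [lintegral_resample hρ hσ (f := fun t => f t.2) (by fun_prop), resampledPair,
    lintegral_finsetSum_measure, Fintype.sum_prod_type]
  refine Finset.sum_congr rfl fun i _ => Finset.sum_congr rfl fun j _ => ?_
  have := hρ i
  have := hσ j
  dsimp only
  rw [lintegral_smul_measure, lintegral_mul_const _ (by fun_prop), smul_eq_mul]

/-- Label `i` has total probability `a i`, the mass of `ρ i μ`, and `y` given `i` has law `c i`;
resampling therefore reproduces the marginals. -/
lemma isCoupling_resampledPair [∀ i, IsProbabilityMeasure (c i)]
    [∀ j, IsProbabilityMeasure (c' j)] (hρ : ∀ i, Measurable (ρ i)) (hσ : ∀ j, Measurable (σ j))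
    [SFinite γ] {μ ν : Measure E} (hγ : IsCoupling γ μ ν)
    (hρ1 : ∀ᵐ x ∂μ, ∑ i, ρ i x = 1) (hσ1 : ∀ᵐ x ∂ν, ∑ j, σ j x = 1)
    {a : ι → ℝ≥0∞} {b : κ → ℝ≥0∞} (ha : ∀ i, μ.withDensity (ρ i) = a i • c i)
    (hb : ∀ j, ν.withDensity (σ j) = b j • c' j) :
    IsCoupling (resampledPair γ ρ σ c c') (∑ i, a i • c i) (∑ j, b j • c' j) := by
  constructor
  · ext s hs
    have hm : Measurable (s.indicator (1 : E → ℝ≥0∞)) := measurable_one.indicator hs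
    rw [← lintegral_indicator_one hs, lintegral_map hm measurable_fst,
      ← lintegral_resample_snd hρ hσ (f := fun w => s.indicator 1 w.1) (by fun_prop),
      lintegral_resample_fst_fst hρ hσ hγ hσ1 (f := fun w => s.indicator 1 w.2) (by fun_prop),
      Measure.finsetSum_apply]
    refine Finset.sum_congr rfl fun i _ => ?_
    rw [ha, lintegral_prod _ (by fun_prop)]
    simp [lintegral_indicator_one hs, mul_comm]
  · ext s hs
    have hm : Measurable (s.indicator (1 : E → ℝ≥0∞)) := measurable_one.indicator hs
    rw [← lintegral_indicator_one hs, lintegral_map hm measurable_snd,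
      ← lintegral_resample_snd hρ hσ (f := fun w => s.indicator 1 w.2) (by fun_prop),
      lintegral_resample_snd_snd hρ hσ hγ hρ1 (f := fun w => s.indicator 1 w.2) (by fun_prop),
      Measure.finsetSum_apply]
    refine Finset.sum_congr rfl fun j _ => ?_
    rw [hb, lintegral_prod _ (by fun_prop)]
    simp [lintegral_indicator_one hs, mul_comm]

end Posterior

/-! ### The resampled plan and its cost. -/

section Bound

variable {d : ℕ} {ι κ : Type*} [Fintype ι] [Fintype κ]

theorem exists_isGaussianMixture_coupling_quadCost_le {a : ι → ℝ≥0∞} {b : κ → ℝ≥0∞}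
    {c : ι → Measure (EuclideanSpace ℝ (Fin d))} {c' : κ → Measure (EuclideanSpace ℝ (Fin d))}
    [∀ i, IsGaussian (c i)] [∀ j, IsGaussian (c' j)] (ha : ∑ i, a i = 1) (hb : ∑ j, b j = 1)
    {γ : Measure (EuclideanSpace ℝ (Fin d) × EuclideanSpace ℝ (Fin d))}
    (hγ : IsCoupling γ (∑ i, a i • c i) (∑ j, b j • c' j)) :
    ∃ η, IsCoupling η (∑ i, a i • c i) (∑ j, b j • c' j) ∧ IsGaussianMixture η ∧
      quadCost η ^ (1 / 2 : ℝ) ≤ quadCost γ ^ (1 / 2 : ℝ)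
        + ((∑ i, a i * quadCost ((c i).prod (c i))) ^ (1 / 2 : ℝ)
          + (∑ j, b j * quadCost ((c' j).prod (c' j))) ^ (1 / 2 : ℝ)) := by
  have hμ : IsProbabilityMeasure (∑ i, a i • c i) := isProbabilityMeasure_sum_smul ha
  have hγp : IsProbabilityMeasure γ := hγ.isProbabilityMeasure
  have hafin : ∀ i, IsFiniteMeasure (a i • c i) := fun i =>
    isFiniteMeasure_of_le _ (Finset.single_le_sum (f := fun i => a i • c i)
      (fun _ _ => Measure.zero_le _) (Finset.mem_univ i))
  have hν : IsProbabilityMeasure (∑ j, b j • c' j) := isProbabilityMeasure_sum_smul hb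
  have hbfin : ∀ j, IsFiniteMeasure (b j • c' j) := fun j =>
    isFiniteMeasure_of_le _ (Finset.single_le_sum (f := fun j => b j • c' j)
      (fun _ _ => Measure.zero_le _) (Finset.mem_univ j))
  obtain ⟨ρ, hρ, hρd, hρ1⟩ := exists_posterior fun i => a i • c i
  obtain ⟨σ, hσ, hσd, hσ1⟩ := exists_posterior fun j => b j • c' j
  have hη := isCoupling_resampledPair hρ hσ hγ hρ1 hσ1 hρd hσd
  have hηp := hη.isProbabilityMeasure
  refine ⟨resampledPair γ ρ σ c c', hη, isGaussianMixture_sum _ _ ?_ fun p => inferInstance, ?_⟩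
  -- The weights sum to one because they add up to the total mass of a coupling of probability
  -- measures.
  · have := hηp.measure_univ
    simpa [resampledPair, Measure.finsetSum_apply] using this
  have hm := measurable_enorm_sub_sq (E := EuclideanSpace ℝ (Fin d))
  have h₁ : ∫⁻ t, ‖t.1.1 - t.2.1‖ₑ ^ 2 ∂(resample γ ρ σ c c') =
      ∑ i, a i * quadCost ((c i).prod (c i)) := by
    rw [lintegral_resample_fst_fst hρ hσ hγ hσ1 hm]
    refine Finset.sum_congr rfl fun i _ => ?_
    rw [hρd, Measure.prod_smul_left, lintegral_smul_measure, quadCost, smul_eq_mul]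
  have h₂ : ∫⁻ t, ‖t.1.2 - t.2.2‖ₑ ^ 2 ∂(resample γ ρ σ c c') =
      ∑ j, b j * quadCost ((c' j).prod (c' j)) := by
    rw [lintegral_resample_snd_snd hρ hσ hγ hρ1 hm]
    refine Finset.sum_congr rfl fun j _ => ?_
    rw [hσd, Measure.prod_smul_left, lintegral_smul_measure, quadCost, smul_eq_mul]
  have h₃ : ∫⁻ t, ‖t.1.1 - t.1.2‖ₑ ^ 2 ∂(resample γ ρ σ c c') = quadCost γ :=
    lintegral_resample_fst hρ hσ hγ hρ1 hσ1 hm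
  have h₄ : ∫⁻ t, ‖t.2.1 - t.2.2‖ₑ ^ 2 ∂(resample γ ρ σ c c') =
      quadCost (resampledPair γ ρ σ c c') := lintegral_resample_snd hρ hσ hm
  rw [← h₁, ← h₂, ← h₃, ← h₄]
  simp_rw [← ENNReal.rpow_two]
  -- Minkowski's inequality in L², used twice on the three-term split of `y - y'` below.
  refine le_trans ?_ ((ENNReal.lintegral_Lp_add_le (by fun_prop) (by fun_prop) one_le_two).trans
    (add_le_add_right
      (ENNReal.lintegral_Lp_add_le (by fun_prop) (by fun_prop) one_le_two) _))
  refine ENNReal.rpow_le_rpow (lintegral_mono fun t => ENNReal.rpow_le_rpow ?_ (by norm_num))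
    (by norm_num)
  simp only [Pi.add_apply]
  have : t.2.1 - t.2.2 = (t.1.1 - t.1.2) + (-(t.1.1 - t.2.1) + (t.1.2 - t.2.2)) := by abel
  rw [this]
  refine (enorm_add_le _ _).trans (add_le_add_right ((enorm_add_le _ _).trans ?_) _)
  rw [enorm_neg]

end Bound

/-! ### Gaussian laws with prescribed mean and covariance. -/

section MomentMatching

lemma dotProduct_of_bilin_mulVec {ι : Type*} [Fintype ι] [DecidableEq ι]
    (B : EuclideanSpace ℝ ι →L[ℝ] EuclideanSpace ℝ ι →L[ℝ] ℝ) (x y : EuclideanSpace ℝ ι) :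
    x.ofLp ⬝ᵥ (Matrix.of fun i j => B (EuclideanSpace.basisFun ι ℝ i)
      (EuclideanSpace.basisFun ι ℝ j)).mulVec y.ofLp = B x y := by
  conv_rhs => rw [← (EuclideanSpace.basisFun ι ℝ).sum_repr x,
    ← (EuclideanSpace.basisFun ι ℝ).sum_repr y]
  simp [dotProduct, Matrix.mulVec, map_sum, Finset.mul_sum]
  rw [Finset.sum_comm]
  refine Finset.sum_congr rfl fun i _ => Finset.sum_congr rfl fun j _ => ?_
  ring

/-- The Gram matrix of the covariance form in the standard basis is positive semidefinite, so it is
the covariance matrix of a Gaussian. -/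
lemma exists_isGaussian_covarianceBilin_eq {ι : Type*} [Fintype ι]
    (γ : Measure (EuclideanSpace ℝ ι)) :
    ∃ γ', IsGaussian γ' ∧ ∫ x, x ∂γ' = ∫ x, x ∂γ ∧ covarianceBilin γ' = covarianceBilin γ := by
  classical
  let S : Matrix ι ι ℝ := Matrix.of fun i j => covarianceBilin γ (EuclideanSpace.basisFun ι ℝ i)
      (EuclideanSpace.basisFun ι ℝ j)
  have hS : S.PosSemidef := by
    refine Matrix.PosSemidef.of_dotProduct_mulVec_nonneg (Matrix.IsHermitian.ext fun i j => ?_)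
      fun x => ?_
    · simp only [S, Matrix.of_apply, star_trivial]
      exact covarianceBilin_comm _ _
    · have h := dotProduct_of_bilin_mulVec (covarianceBilin γ) (WithLp.toLp 2 x) (WithLp.toLp 2 x)
      rw [star_trivial, h]
      exact covarianceBilin_self_nonneg _
  refine ⟨multivariateGaussian (∫ x, x ∂γ) S, inferInstance, integral_id_multivariateGaussian, ?_⟩
  ext x y
  rw [covarianceBilin_multivariateGaussian hS, dotProduct_of_bilin_mulVec]

lemma covarianceBilinDual_map_clm {E F : Type*} [NormedAddCommGroup E] [NormedSpace ℝ E]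
    [MeasurableSpace E] [BorelSpace E] [CompleteSpace E]
    [NormedAddCommGroup F] [NormedSpace ℝ F] [MeasurableSpace F] [BorelSpace F] [CompleteSpace F]
    [SecondCountableTopology F]
    {μ : Measure E} [IsFiniteMeasure μ] (hμ : MemLp id 2 μ) (A : E →L[ℝ] F)
    (L₁ L₂ : StrongDual ℝ F) :
    covarianceBilinDual (μ.map A) L₁ L₂ = covarianceBilinDual μ (L₁.comp A) (L₂.comp A) := by
  have h : MemLp id 2 (μ.map A) :=
    (memLp_map_measure_iff (by fun_prop) (by fun_prop)).2 (A.comp_memLp' hμ)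
  rw [covarianceBilinDual_eq_covariance h, covarianceBilinDual_eq_covariance hμ,
    covariance_map (by fun_prop) (by fun_prop) (by fun_prop)]
  rfl

/-- Every law with finite second moments shares its mean and covariance with a Gaussian law. -/
theorem exists_isGaussian_covarianceBilinDual_eq {F : Type*} [NormedAddCommGroup F]
    [NormedSpace ℝ F] [FiniteDimensional ℝ F] [MeasurableSpace F] [BorelSpace F]
    {γ : Measure F} [IsProbabilityMeasure γ] (hγ : MemLp id 2 γ) :
    ∃ γ', IsGaussian γ' ∧ ∫ x, x ∂γ' = ∫ x, x ∂γ ∧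
      covarianceBilinDual γ' = covarianceBilinDual γ := by
  have := FiniteDimensional.complete ℝ F
  have := FiniteDimensional.proper ℝ F
  -- The intended `F` is a product with the sup norm, which has no inner product; the Gaussian is
  -- built on a Euclidean copy and pulled back, with covariances tested on dual vectors.
  let e : F ≃L[ℝ] EuclideanSpace ℝ (Fin (Module.finrank ℝ F)) := toEuclidean
  have he : MemLp id 2 (γ.map (e : F →L[ℝ] EuclideanSpace ℝ (Fin (Module.finrank ℝ F)))) :=
    (memLp_map_measure_iff (by fun_prop) (by fun_prop)).2
      ((e : F →L[ℝ] EuclideanSpace ℝ (Fin (Module.finrank ℝ F))).comp_memLp' hγ)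
  obtain ⟨δ, hδ, hm, hc⟩ := exists_isGaussian_covarianceBilin_eq
    (γ.map (e : F →L[ℝ] EuclideanSpace ℝ (Fin (Module.finrank ℝ F))))
  have hid : ∀ (x : F), e.symm (e x) = x := fun x => e.symm_apply_apply x
  refine ⟨δ.map (e.symm : _ →L[ℝ] F), inferInstance, ?_, ?_⟩
  · rw [ContinuousLinearMap.integral_id_map IsGaussian.integrable_id, hm,
      ContinuousLinearMap.integral_id_map (hγ.integrable (by norm_num))]
    exact hid _
  · have hc' : covarianceBilinDual δ = covarianceBilinDual
        (γ.map (e : F →L[ℝ] EuclideanSpace ℝ (Fin (Module.finrank ℝ F)))) := by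
      ext L₁ L₂
      obtain ⟨x, rfl⟩ := (InnerProductSpace.toDual ℝ _).surjective L₁
      obtain ⟨y, rfl⟩ := (InnerProductSpace.toDual ℝ _).surjective L₂
      exact congrArg (fun B => B x y) hc
    ext L₁ L₂
    rw [covarianceBilinDual_map_clm IsGaussian.memLp_two_id, hc', covarianceBilinDual_map_clm hγ]
    congr 2 <;> ext x <;> simp

end MomentMatching

/-! ### Gaussian marginals, and the cost between independent copies. -/

section Gaussian

variable {d : ℕ}

/-- The `i`-th coordinate of the displacement `y₀ - y₁`, as a continuous linear form. -/
noncomputable def displacementCoord (i : Fin d) :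
    StrongDual ℝ (EuclideanSpace ℝ (Fin d) × EuclideanSpace ℝ (Fin d)) :=
  (EuclideanSpace.proj i).comp
    (ContinuousLinearMap.fst ℝ _ _ - ContinuousLinearMap.snd ℝ _ _)

/-- The cost is a sum of second moments of linear forms, so it depends on the plan only through its
mean and covariance. -/
lemma quadCost_eq_sum_variance
    {γ : Measure (EuclideanSpace ℝ (Fin d) × EuclideanSpace ℝ (Fin d))} [IsProbabilityMeasure γ]
    (hγ : MemLp id 2 γ) :
    quadCost γ = ENNReal.ofReal (∑ i, (Var[displacementCoord i; γ]
      + displacementCoord i (∫ z, z ∂γ) ^ 2)) := by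
  rw [(quadCost_eq_ofReal_integral hγ).2]
  congr 1
  have hL : ∀ i : Fin d, MemLp (displacementCoord i) 2 γ := fun i =>
    (displacementCoord i).comp_memLp' hγ
  have hsq : ∀ z : EuclideanSpace ℝ (Fin d) × EuclideanSpace ℝ (Fin d),
      ‖z.1 - z.2‖ ^ 2 = ∑ i, (displacementCoord i z) ^ 2 := fun z => by
    rw [EuclideanSpace.real_norm_sq_eq]
    rfl
  simp_rw [hsq]
  rw [integral_finsetSum _ fun i _ => (hL i).integrable_sq]
  refine Finset.sum_congr rfl fun i _ => ?_
  rw [variance_eq_sub (hL i), ← (displacementCoord i).integral_comp_id_comm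
    (hγ.integrable (by norm_num))]
  simp

theorem exists_isGaussian_coupling_quadCost_eq {μ ν : Measure (EuclideanSpace ℝ (Fin d))}
    [IsGaussian μ] [IsGaussian ν]
    {γ : Measure (EuclideanSpace ℝ (Fin d) × EuclideanSpace ℝ (Fin d))} (hγ : IsCoupling γ μ ν) :
    ∃ γ', IsCoupling γ' μ ν ∧ IsGaussian γ' ∧ quadCost γ' = quadCost γ := by
  have hp : IsProbabilityMeasure γ := hγ.isProbabilityMeasure
  have hm : MemLp id 2 γ := hγ.memLp_id IsGaussian.memLp_two_id IsGaussian.memLp_two_id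
  obtain ⟨γ', hG, hmean, hcov⟩ := exists_isGaussian_covarianceBilinDual_eq hm
  -- Linear images of `γ'` and `γ` share mean and covariance; when the image of `γ` is Gaussian,
  -- this forces equality. Applied to the two projections, it gives the marginals.
  have key : ∀ A : EuclideanSpace ℝ (Fin d) × EuclideanSpace ℝ (Fin d) →L[ℝ]
      EuclideanSpace ℝ (Fin d), IsGaussian (γ.map A) → γ'.map A = γ.map A := fun A hA => by
    refine IsGaussian.ext_covarianceBilinDual ?_ ?_
    · simp only [id]
      rw [A.integral_id_map IsGaussian.integrable_id, A.integral_id_map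
        (hm.integrable (by norm_num)), hmean]
    · ext L₁ L₂
      rw [covarianceBilinDual_map_clm hm, covarianceBilinDual_map_clm IsGaussian.memLp_two_id, hcov]
  refine ⟨γ', ⟨?_, ?_⟩, hG, ?_⟩
  · exact (key (ContinuousLinearMap.fst ℝ _ _) (by
      rw [ContinuousLinearMap.coe_fst', hγ.1]; infer_instance)).trans hγ.1
  · exact (key (ContinuousLinearMap.snd ℝ _ _) (by
      rw [ContinuousLinearMap.coe_snd', hγ.2]; infer_instance)).trans hγ.2
  · rw [quadCost_eq_sum_variance hm, quadCost_eq_sum_variance IsGaussian.memLp_two_id, hmean]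
    simp_rw [← covarianceBilinDual_self_eq_variance hm,
      ← covarianceBilinDual_self_eq_variance (IsGaussian.memLp_two_id (μ := γ')), hcov]

/-- For independent copies the means cancel and the variances add, whence the factor 2. -/
lemma quadCost_multivariateGaussian_prod_self (m : EuclideanSpace ℝ (Fin d))
    {S : Matrix (Fin d) (Fin d) ℝ} (hS : S.PosSemidef) :
    quadCost ((multivariateGaussian m S).prod (multivariateGaussian m S)) =
      ENNReal.ofReal (2 * S.trace) := by
  rw [quadCost_eq_sum_variance IsGaussian.memLp_two_id]
  have hG : MemLp id 2 (multivariateGaussian m S) := IsGaussian.memLp_two_id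
  congr 1
  rw [Matrix.trace, Finset.mul_sum]
  refine Finset.sum_congr rfl fun i _ => ?_
  have h₁ : (displacementCoord i).comp (.inl ℝ (EuclideanSpace ℝ (Fin d)) _) =
      EuclideanSpace.proj i := by
    ext x; simp [displacementCoord]
  have h₂ : (displacementCoord i).comp (.inr ℝ (EuclideanSpace ℝ (Fin d)) _) =
      -EuclideanSpace.proj i := by
    ext x; simp [displacementCoord]
  have hv : Var[(EuclideanSpace.proj i : EuclideanSpace ℝ (Fin d) →L[ℝ] ℝ);
      multivariateGaussian m S] = S i i := variance_eval_multivariateGaussian hS i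
  have hmean : displacementCoord i (∫ z, z ∂((multivariateGaussian m S).prod
      (multivariateGaussian m S))) = 0 := by
    rw [← (displacementCoord i).integral_comp_id_comm IsGaussian.integrable_id,
      integral_continuousLinearMap_prod IsGaussian.integrable_id IsGaussian.integrable_id, h₁, h₂]
    simp [integral_neg]
  rw [variance_dual_prod hG hG, h₁, h₂, hmean]
  simp only [FunLike.coe_neg, variance_neg, hv, Matrix.diag_apply]
  ring

end Gaussian

/-! ### Plans between finitely supported measures. -/

section Dirac

lemma IsDiracMixture.exists_finset {E : Type*} [MeasurableSpace E] [MeasurableSingletonClass E]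
    {μ : Measure E} (h : IsDiracMixture μ) :
    ∃ s : Finset E, ∀ᵐ x ∂μ, x ∈ s := by
  classical
  obtain ⟨K, p, y, hp, rfl⟩ := h
  refine ⟨Finset.univ.image y, ?_⟩
  rw [ae_iff, Measure.finsetSum_apply]
  refine Finset.sum_eq_zero fun k _ => ?_
  have hms : MeasurableSet {a | a ∉ Finset.univ.image y} :=
    (Finset.univ.image y).measurableSet.compl
  rw [Measure.smul_apply, Measure.dirac_apply' _ hms]
  simp

lemma eq_sum_smul_dirac_of_ae_mem_finset {Ω : Type*} [MeasurableSpace Ω]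
    [MeasurableSingletonClass Ω] {γ : Measure Ω} {s : Finset Ω} (h : ∀ᵐ z ∂γ, z ∈ s) :
    γ = ∑ z : s, γ {z.1} • Measure.dirac z.1 := by
  classical
  ext t ht
  rw [Measure.finsetSum_apply, Finset.sum_coe_sort s fun z => (γ {z} • Measure.dirac z) t]
  have hae : γ t = γ ((s.filter (· ∈ t) : Finset Ω) : Set Ω) := by
    refine measure_congr ?_
    filter_upwards [h] with z hz
    exact propext ⟨fun hzt => Finset.mem_coe.2 (Finset.mem_filter.2 ⟨hz, hzt⟩),
      fun hzt => (Finset.mem_filter.1 (Finset.mem_coe.1 hzt)).2⟩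
  rw [hae, ← sum_measure_singleton, Finset.sum_filter]
  refine Finset.sum_congr rfl fun z _ => ?_
  rw [Measure.smul_apply, Measure.dirac_apply' _ ht, smul_eq_mul]
  by_cases hz : z ∈ t <;> simp [hz]

/-- A plan is carried by the finite product of the carriers of its marginals, so it is a finite sum
of Dirac masses, which are degenerate Gaussians. -/
theorem IsCoupling.isGaussianMixture_of_isDiracMixture {E : Type*} [NormedAddCommGroup E]
    [NormedSpace ℝ E] [MeasurableSpace E] [BorelSpace E] [SecondCountableTopology E]
    {μ ν : Measure E} {γ : Measure (E × E)} [IsProbabilityMeasure γ] (hγ : IsCoupling γ μ ν)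
    (hμ : IsDiracMixture μ) (hν : IsDiracMixture ν) : IsGaussianMixture γ := by
  obtain ⟨s, hs⟩ := hμ.exists_finset
  obtain ⟨t, ht⟩ := hν.exists_finset
  have h : ∀ᵐ z ∂γ, z ∈ s ×ˢ t := by
    filter_upwards [ae_of_ae_map (p := (· ∈ s)) measurable_fst.aemeasurable (by rwa [hγ.1]),
      ae_of_ae_map (p := (· ∈ t)) measurable_snd.aemeasurable (by rwa [hγ.2])] with z h₁ h₂
    exact Finset.mem_product.2 ⟨h₁, h₂⟩
  have hsum := eq_sum_smul_dirac_of_ae_mem_finset h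
  rw [hsum]
  refine isGaussianMixture_sum _ _ ?_ fun z => inferInstance
  have := congrArg (fun m => m Set.univ) hsum
  simpa [Measure.finsetSum_apply] using this.symm

end Dirac

/-! ### Optimality of positive affine maps by duality. -/

section Affine

/-- A right inverse on the range, extended to the whole space. It stands in for the inverse of a
singular `A` in the dual potential. -/
lemma LinearMap.exists_comp_comp_eq_self {K V W : Type*} [Field K] [AddCommGroup V] [Module K V]
    [AddCommGroup W] [Module K W] (A : V →ₗ[K] W) :
    ∃ B : W →ₗ[K] V, ∀ x, A (B (A x)) = A x := by
  obtain ⟨g, hg⟩ := A.rangeRestrict.exists_rightInverse_of_surjective A.range_rangeRestrict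
  obtain ⟨B, hB⟩ := LinearMap.exists_extend g
  refine ⟨B, fun x => ?_⟩
  have h₁ : B (A x) = g (A.rangeRestrict x) := LinearMap.congr_fun hB (A.rangeRestrict x)
  rw [h₁]
  exact congrArg Subtype.val (LinearMap.congr_fun hg (A.rangeRestrict x))

variable {d : ℕ}

/-- Weak duality: a plan on which a dominated pair of potentials attains the cost is optimal. -/
lemma quadCost_le_of_potentials {μ ν : Measure (EuclideanSpace ℝ (Fin d))}
    {γ γ₀ : Measure (EuclideanSpace ℝ (Fin d) × EuclideanSpace ℝ (Fin d))}
    (hγ : IsCoupling γ μ ν) (hγ₀ : IsCoupling γ₀ μ ν) (hm : MemLp id 2 γ) (hm₀ : MemLp id 2 γ₀)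
    {f g : EuclideanSpace ℝ (Fin d) → ℝ} (hf : Integrable f μ) (hg : Integrable g ν)
    (hle : ∀ᵐ z ∂γ, f z.1 + g z.2 ≤ ‖z.1 - z.2‖ ^ 2)
    (heq : ∀ᵐ z ∂γ₀, f z.1 + g z.2 = ‖z.1 - z.2‖ ^ 2) :
    quadCost γ₀ ≤ quadCost γ := by
  have key : ∀ η, IsCoupling η μ ν → Integrable (fun z => f z.1 + g z.2) η ∧
      ∫ z, f z.1 + g z.2 ∂η = ∫ x, f x ∂μ + ∫ y, g y ∂ν := fun η hη => by
    have hf' : Integrable f (η.map Prod.fst) := by rwa [hη.1]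
    have hg' : Integrable g (η.map Prod.snd) := by rwa [hη.2]
    have h₁ : Integrable (fun z : _ × _ => f z.1) η := hf'.comp_measurable measurable_fst
    have h₂ : Integrable (fun z : _ × _ => g z.2) η := hg'.comp_measurable measurable_snd
    refine ⟨h₁.add h₂, ?_⟩
    rw [integral_add h₁ h₂, ← integral_map measurable_fst.aemeasurable hf'.1,
      ← integral_map measurable_snd.aemeasurable hg'.1, hη.1, hη.2]
  rw [(quadCost_eq_ofReal_integral hm).2, (quadCost_eq_ofReal_integral hm₀).2,
    ← integral_congr_ae heq, (key γ₀ hγ₀).2, ← (key γ hγ).2]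
  exact ENNReal.ofReal_le_ofReal
    (integral_mono_ae (key γ hγ).1 (quadCost_eq_ofReal_integral hm).1 hle)

lemma integrable_inner_of_memLp_two {Ω E : Type*} [MeasurableSpace Ω] [NormedAddCommGroup E]
    [InnerProductSpace ℝ E] {μ : Measure Ω} {u v : Ω → E} (hu : MemLp u 2 μ) (hv : MemLp v 2 μ) :
    Integrable (fun x => inner ℝ (u x) (v x)) μ := by
  refine ((hu.norm.integrable_mul hv.norm)).mono (hu.1.inner hv.1) (ae_of_all _ fun x => ?_)
  simpa using abs_real_inner_le_norm (u x) (v x)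

theorem isCoupling_graph {E : Type*} [MeasurableSpace E] {μ : Measure E} {T : E → E}
    (hT : Measurable T) : IsCoupling (μ.map fun x => (x, T x)) μ (μ.map T) := by
  constructor
  · rw [Measure.map_map measurable_fst (by fun_prop)]
    exact Measure.map_id
  · rw [Measure.map_map measurable_snd (by fun_prop)]
    rfl

theorem quadCost_graph_le {μ : Measure (EuclideanSpace ℝ (Fin d))} [IsProbabilityMeasure μ]
    (hμ : MemLp id 2 μ) {T : EuclideanSpace ℝ (Fin d) →ᵃ[ℝ] EuclideanSpace ℝ (Fin d)}
    (hT : T.linear.IsPositive)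
    {γ : Measure (EuclideanSpace ℝ (Fin d) × EuclideanSpace ℝ (Fin d))}
    (hγ : IsCoupling γ μ (μ.map T)) : quadCost (μ.map fun x => (x, T x)) ≤ quadCost γ := by
  obtain ⟨B, hB⟩ := T.linear.exists_comp_comp_eq_self
  set A := T.linear with hA
  set b := T 0 with hb
  have hTx : ∀ x, T x = A x + b := fun x => by
    rw [hA, hb, T.decomp]; simp
  have hTc : Continuous T := T.continuous_of_finiteDimensional
  have hAc : Continuous A := A.continuous_of_finiteDimensional
  have hBc : Continuous B := B.continuous_of_finiteDimensional
  have hTmem : MemLp id 2 (μ.map T) := by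
    refine (memLp_map_measure_iff (by fun_prop) (by fun_prop)).2 ?_
    have : id ∘ T = fun x => A.toContinuousLinearMap x + b := funext hTx
    rw [this]
    exact (A.toContinuousLinearMap.comp_memLp' hμ).add (memLp_const b)
  have hγ₀ : IsCoupling (μ.map fun x => (x, T x)) μ (μ.map T) := isCoupling_graph hTc.measurable
  have hprob : IsProbabilityMeasure (μ.map T) :=
    Measure.isProbabilityMeasure_map hTc.measurable.aemeasurable
  have hinner : ∀ x y, inner ℝ (B (A x)) (A y) = inner ℝ x (A y) := fun x y => by
    rw [← hT.isSymmetric, hB, hT.isSymmetric]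
  -- With `φ x = ⟪A x, x⟫ / 2 + ⟪b, x⟫`, whose gradient is `T`, these are `‖x‖² - 2 φ x` and `‖y‖² -
  -- 2 φ* y`. The Legendre transform `φ*` is infinite off the range of `T`; the formula with `B`
  -- agrees with it on that range and stays finite elsewhere.
  let f : EuclideanSpace ℝ (Fin d) → ℝ := fun x => ‖x‖ ^ 2 - inner ℝ (A x) x - 2 * inner ℝ b x
  let g : EuclideanSpace ℝ (Fin d) → ℝ := fun y => ‖y‖ ^ 2 - inner ℝ (B (y - b)) (y - b)
  have hf : Integrable f μ :=
    ((hμ.integrable_norm_pow (by norm_num)).sub (integrable_inner_of_memLp_two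
      (A.toContinuousLinearMap.comp_memLp' hμ) hμ)).sub
      ((integrable_inner_of_memLp_two (memLp_const b) hμ).const_mul 2)
  have hyb : MemLp (fun y => y - b) 2 (μ.map T) := hTmem.sub (memLp_const b)
  have hg : Integrable g (μ.map T) :=
    (hTmem.integrable_norm_pow (by norm_num)).sub (integrable_inner_of_memLp_two
      (B.toContinuousLinearMap.comp_memLp' hyb) hyb)
  -- The duality gap at `(x, T x')` is exactly `⟪A (x - x'), x - x'⟫`: nonnegative by positivity of
  -- `A`, and zero on the graph.
  have hval : ∀ x x', f x + g (T x') =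
      ‖x - T x'‖ ^ 2 - inner ℝ (A (x - x')) (x - x') := fun x x' => by
    have h₁ : g (T x') = ‖T x'‖ ^ 2 - inner ℝ x' (A x') := by
      simp only [g]
      rw [hTx, add_sub_cancel_right, hinner]
    have h₂ : inner ℝ (A x) x' = inner ℝ x (A x') := hT.isSymmetric x x'
    rw [h₁, norm_sub_sq_real, map_sub, inner_sub_left, inner_sub_right, inner_sub_right, h₂,
      real_inner_comm x' (A x'), real_inner_comm x (A x')]
    simp only [f]
    rw [hTx x', inner_add_right, real_inner_comm x b]
    ring
  refine quadCost_le_of_potentials hγ hγ₀ (hγ.memLp_id hμ hTmem) (hγ₀.memLp_id hμ hTmem) hf hg ?_ ?_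
  -- The inequality is only available on the range of `T`, which carries the second marginal; there
  -- `y = T x'` with `x' = B (y - b)`.
  · have hrange : ∀ᵐ y ∂(μ.map T), T (B (y - b)) = y := by
      refine (ae_map_iff hTc.measurable.aemeasurable
        (measurableSet_eq_fun (by fun_prop) (by fun_prop))).2 (ae_of_all _ fun x => ?_)
      rw [hTx x, add_sub_cancel_right, hTx, hB]
    have := ae_of_ae_map (f := Prod.snd) (μ := γ) (p := fun y => T (B (y - b)) = y)
      measurable_snd.aemeasurable (by rwa [hγ.2])
    filter_upwards [this] with z hx'
    rw [← hx', hval]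
    have := hT.inner_nonneg_left (z.1 - B (z.2 - b))
    linarith
  · refine (ae_map_iff (by fun_prop) ?_).2 (ae_of_all _ fun x => ?_)
    · have h₁ : Continuous f := by fun_prop
      have h₂ : Continuous g := by fun_prop
      exact measurableSet_eq_fun (by fun_prop) (by fun_prop)
    · dsimp only
      rw [hval]
      simp

lemma IsGaussianMixture.map_graph {μ : Measure (EuclideanSpace ℝ (Fin d))}
    (hμ : IsGaussianMixture μ) (T : EuclideanSpace ℝ (Fin d) →ᵃ[ℝ] EuclideanSpace ℝ (Fin d)) :
    IsGaussianMixture (μ.map fun x => (x, T x)) := by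
  have : (fun x => (x, T x)) = fun x =>
      (ContinuousLinearMap.id ℝ _).prod T.linear.toContinuousLinearMap x + (0, T 0) := by
    ext1 x
    rw [T.decomp]
    simp
  rw [this]
  exact hμ.map_clm_add_const _ _

end Affine

/-! ### Assembly for explicit mixtures. -/

lemma isGaussianMixture_gaussianMixture {d K : ℕ} {p : Fin K → ℝ}
    (hp : p ∈ stdSimplex ℝ (Fin K)) (m : Fin K → EuclideanSpace ℝ (Fin d))
    (S : Fin K → Matrix (Fin d) (Fin d) ℝ) : IsGaussianMixture (gaussianMixture p m S) :=
  ⟨K, p, _, hp, fun _ => isGaussian_multivariateGaussian, rfl⟩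

lemma rpow_sum_mul_quadCost_eq {d K : ℕ} {p : Fin K → ℝ} (hp : p ∈ stdSimplex ℝ (Fin K))
    (m : Fin K → EuclideanSpace ℝ (Fin d)) {S : Fin K → Matrix (Fin d) (Fin d) ℝ}
    (hS : ∀ k, (S k).PosSemidef) :
    (∑ k, ENNReal.ofReal (p k) * quadCost
      ((multivariateGaussian (m k) (S k)).prod (multivariateGaussian (m k) (S k)))) ^ (1 / 2 : ℝ) =
    ENNReal.ofReal √(2 * ∑ k, p k * (S k).trace) := by
  have hnn : ∀ k, 0 ≤ p k * (2 * (S k).trace) := fun k =>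
    mul_nonneg (hp.1 k) (mul_nonneg zero_le_two (hS k).trace_nonneg)
  simp_rw [quadCost_multivariateGaussian_prod_self _ (hS _), ← ENNReal.ofReal_mul (hp.1 _)]
  rw [← ENNReal.ofReal_sum_of_nonneg fun k _ => hnn k,
    ENNReal.ofReal_rpow_of_nonneg (Finset.sum_nonneg fun k _ => hnn k) (by norm_num),
    ← Real.sqrt_eq_rpow, Finset.mul_sum]
  simp_rw [mul_left_comm]

theorem MW2_gaussianMixture_le {d K₀ K₁ : ℕ}
    {p₀ : Fin K₀ → ℝ} (m₀ : Fin K₀ → EuclideanSpace ℝ (Fin d))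
    {S₀ : Fin K₀ → Matrix (Fin d) (Fin d) ℝ}
    {p₁ : Fin K₁ → ℝ} (m₁ : Fin K₁ → EuclideanSpace ℝ (Fin d))
    {S₁ : Fin K₁ → Matrix (Fin d) (Fin d) ℝ}
    (hp₀ : p₀ ∈ stdSimplex ℝ (Fin K₀)) (hS₀ : ∀ k, (S₀ k).PosSemidef)
    (hp₁ : p₁ ∈ stdSimplex ℝ (Fin K₁)) (hS₁ : ∀ k, (S₁ k).PosSemidef) :
    MW2 (gaussianMixture p₀ m₀ S₀) (gaussianMixture p₁ m₁ S₁) ≤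
      W2 (gaussianMixture p₀ m₀ S₀) (gaussianMixture p₁ m₁ S₁)
      + (ENNReal.ofReal √(2 * ∑ k, p₀ k * (S₀ k).trace)
        + ENNReal.ofReal √(2 * ∑ k, p₁ k * (S₁ k).trace)) := by
  -- The constant is moved to the left by truncated subtraction so that the bound can be tested on
  -- each plan through `le_W2`.
  rw [← tsub_le_iff_right]
  refine le_W2 fun γ hγ => ?_
  rw [tsub_le_iff_right]
  obtain ⟨η, hη, hηG, hle⟩ := exists_isGaussianMixture_coupling_quadCost_le
    (sum_ofReal_of_mem_stdSimplex hp₀) (sum_ofReal_of_mem_stdSimplex hp₁) hγ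
  rw [rpow_sum_mul_quadCost_eq hp₀ m₀ hS₀, rpow_sum_mul_quadCost_eq hp₁ m₁ hS₁] at hle
  exact (MW2_le hη hηG).trans hle

theorem mainTheorem3 {d K₀ K₁ : ℕ}
    (p₀ : Fin K₀ → ℝ) (m₀ : Fin K₀ → EuclideanSpace ℝ (Fin d))
    (S₀ : Fin K₀ → Matrix (Fin d) (Fin d) ℝ)
    (p₁ : Fin K₁ → ℝ) (m₁ : Fin K₁ → EuclideanSpace ℝ (Fin d))
    (S₁ : Fin K₁ → Matrix (Fin d) (Fin d) ℝ)
    (hp₀ : p₀ ∈ stdSimplex ℝ (Fin K₀)) (hS₀ : ∀ k, (S₀ k).PosSemidef)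
    (hp₁ : p₁ ∈ stdSimplex ℝ (Fin K₁)) (hS₁ : ∀ k, (S₁ k).PosSemidef)
    (μ₀ μ₁ : Measure (EuclideanSpace ℝ (Fin d)))
    (hμ₀ : μ₀ = gaussianMixture p₀ m₀ S₀) (hμ₁ : μ₁ = gaussianMixture p₁ m₁ S₁) :
    MW2 μ₀ μ₁ ≠ ∞ ∧
    W2 μ₀ μ₁ ≤ MW2 μ₀ μ₁ ∧
    MW2 μ₀ μ₁ ≤ W2 μ₀ μ₁
      + (ENNReal.ofReal √(2 * ∑ k, p₀ k * (S₀ k).trace)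
        + ENNReal.ofReal √(2 * ∑ k, p₁ k * (S₁ k).trace)) ∧
    (IsGaussian μ₀ → IsGaussian μ₁ → W2 μ₀ μ₁ = MW2 μ₀ μ₁) ∧
    (IsDiracMixture μ₀ → IsDiracMixture μ₁ → W2 μ₀ μ₁ = MW2 μ₀ μ₁) ∧
    (∀ T : EuclideanSpace ℝ (Fin d) →ᵃ[ℝ] EuclideanSpace ℝ (Fin d),
      T.linear.IsPositive → μ₁ = μ₀.map T → W2 μ₀ μ₁ = MW2 μ₀ μ₁) := by
  have hG₀ : IsGaussianMixture μ₀ := hμ₀ ▸ isGaussianMixture_gaussianMixture hp₀ m₀ S₀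
  have hG₁ : IsGaussianMixture μ₁ := hμ₁ ▸ isGaussianMixture_gaussianMixture hp₁ m₁ S₁
  have := hG₀.isProbabilityMeasure
  refine ⟨MW2_ne_top hG₀ hG₁, W2_le_MW2, ?_, fun h₀ h₁ => ?_, fun h₀ h₁ => ?_, fun T hT hμT => ?_⟩
  · rw [hμ₀, hμ₁]
    exact MW2_gaussianMixture_le m₀ m₁ hp₀ hS₀ hp₁ hS₁
  · refine W2_eq_MW2_of_forall_exists fun γ hγ => ?_
    obtain ⟨γ', hγ', hG, hcost⟩ := exists_isGaussian_coupling_quadCost_eq hγ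
    exact ⟨γ', hγ', IsGaussian.isGaussianMixture hG, hcost.le⟩
  · refine W2_eq_MW2_of_forall_exists fun γ hγ => ?_
    have := hγ.isProbabilityMeasure
    exact ⟨γ, hγ, hγ.isGaussianMixture_of_isDiracMixture h₀ h₁, le_rfl⟩
  · subst hμT
    exact W2_eq_MW2_of_forall_exists fun γ hγ =>
      ⟨_, isCoupling_graph T.continuous_of_finiteDimensional.measurable, hG₀.map_graph T,
        quadCost_graph_le hG₀.memLp_two_id hT hγ⟩
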